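/- Let $n\ge 1$ and $k\ge 0$ be integers. Drop $k$ balls independently and uniformly into $n$ boxes, let $b_i$ be the box of ball $i$, and let $W=W_{n,k}=|\{(i,j,l): 1\le i<j<l\le k,\ b_i=b_j=b_l\}|$ be the number of triples of balls that share a box. Write $\mathcal L(W)$ for the law of $W$, $\mathrm{Poi}_\lambda$ for the Poisson distribution with mean $\lambda$, and $\|\mu-\nu\|_{TV}=\sup_A|\mu(A)-\nu(A)|$. Then $$\left\|\mathcal L(W_{n,k})-\mathrm{Poi}_{\binom{k}{3}\frac1{n^2}}\right\|_{TV}=O\!\left(\frac{k^4}{n^3}\right),$$ that is, there is an absolute constant $C$ such that the left side is at most $C\,k^4/n^3$ for all $n\ge1$ and $k\ge0$. In particular, let $\theta>0$ be fixed and let $k=\theta n^{2/3}$ asymptotically, i.e. let $(n_j)$ and $(k_j)$ be sequences of integers with $n_j\ge1$, $k_j\ge0$, $n_j\to\infty$ and $k_j/n_j^{2/3}\to\theta$. Then $W_{n_j,k_j}$ converges in distribution to $\mathrm{Poi}_{\theta^3/6}$ as $j\to\infty$, and this limit is non-trivial: it is not concentrated at a single point. -/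

import Mathlib

open MeasureTheory ProbabilityTheory Filter Topology
open scoped NNReal

namespace BallsInBoxes

/-- Total variation distance `sup_A |μ(A) - ν(A)|` over all measurable sets `A`
(for finite measures the supremum is of a bounded set). -/
noncomputable def tvDist {α : Type*} [MeasurableSpace α] (μ ν : Measure α) : ℝ :=
  ⨆ A : {A : Set α // MeasurableSet A}, |μ.real A - ν.real A|

/-- The law of `k` balls dropped independently and uniformly into `n ≥ 1` boxes. An arrangement
is `b : Fin k → Fin n`, where `b i` is the box of ball `i`. -/
noncomputable def dropLaw (n k : ℕ) [NeZero n] : Measure (Fin k → Fin n) :=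
  Measure.pi fun _ => (PMF.uniformOfFintype (Fin n)).toMeasure

instance (n k : ℕ) [NeZero n] : IsProbabilityMeasure (dropLaw n k) := by
  unfold dropLaw
  infer_instance

/-- The number of triples of balls `i < j < l` lying in the same box. -/
def tripleMatches {n k : ℕ} (b : Fin k → Fin n) : ℕ :=
  (Finset.univ.filter fun t : Fin k × Fin k × Fin k =>
    t.1 < t.2.1 ∧ t.2.1 < t.2.2 ∧ b t.1 = b t.2.1 ∧ b t.2.1 = b t.2.2).card

end BallsInBoxes

/-! The variable W is a sum, over the 3-subsets S of the balls, of the indicator that S lies in one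
box. Each indicator has mean n⁻², and that of S is independent of those of all triples disjoint from
S. The sum is thus rare and locally dependent, and the Chen–Stein method applies.

For an event A, `exists_stein_solution` solves the Stein equation of Poi_r with a function g of
increments at most 1. Averaging the equation at W bounds the difference of the two probabilities of
A by correlations within dependency neighbourhoods (`chenStein_bound`). Two distinct triples that
meet have a union of u = 4 or 5 balls, and both are matched with probability n^(1-u) (`expect_mono`,
`mono_union`). There are O(k^u) such pairs, so the error is O(k³/n⁴ + k⁴/n³ + k⁵/n⁴). This is
O(k⁴/n³) if k ≤ n; otherwise k⁴/n³ ≥ 1 and the bound is trivial.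

If k ~ θ n^(2/3), the error tends to 0 and the rate to θ³/6; Poisson probabilities are continuous in
the rate. -/

namespace BallsInBoxes

/-! ### The Stein equation of the Poisson distribution -/

open scoped BigOperators Nat

/-- The mass that the Poisson distribution with rate `r` gives to `m`. -/
noncomputable def poissonMass (r : ℝ≥0) (m : ℕ) : ℝ := Real.exp (-r) * r ^ m / m !

lemma poissonMass_nonneg (r : ℝ≥0) (m : ℕ) : 0 ≤ poissonMass r m := by
  unfold poissonMass; positivity

lemma poissonMass_pos {r : ℝ≥0} (hr : 0 < r) (m : ℕ) : 0 < poissonMass r m := by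
  unfold poissonMass; positivity

lemma hasSum_poissonMass (r : ℝ≥0) : HasSum (poissonMass r) 1 := hasSum_one_poissonMeasure r

lemma succ_mul_poissonMass_succ (r : ℝ≥0) (m : ℕ) :
    ((m : ℝ) + 1) * poissonMass r (m + 1) = r * poissonMass r m := by
  unfold poissonMass
  rw [Nat.factorial_succ]
  push_cast
  field_simp
  ring

lemma poissonMeasure_real_eq_tsum (r : ℝ≥0) (A : Set ℕ) :
    (poissonMeasure r).real A = ∑' m, A.indicator (poissonMass r) m := by
  rw [← integral_indicator_one (MeasurableSet.of_discrete), integral_poissonMeasure]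
  refine tsum_congr fun m => ?_
  by_cases h : m ∈ A <;> simp [h, poissonMass]

lemma summable_indicator_poissonMass (r : ℝ≥0) (A : Set ℕ) :
    Summable (A.indicator (poissonMass r)) :=
  (hasSum_poissonMass r).summable.indicator A

/-- The canonical solution `g` of the Stein equation
`r * g m - m * g (m - 1) = 1_A m - Poi_r(A)`. -/
noncomputable def steinSolution (r : ℝ≥0) (A : Set ℕ) (m : ℕ) : ℝ :=
  (∑ i ∈ Finset.range (m + 1),
    (A.indicator (poissonMass r) i - (poissonMeasure r).real A * poissonMass r i)) /
    (r * poissonMass r m)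

/-- Multiplied by the mass of m, the equation telescopes, because m π(m) = r π(m-1). At m = 0 the
truncated `m - 1` is harmless: its coefficient vanishes. -/
lemma steinSolution_equation {r : ℝ≥0} (hr : 0 < r) (A : Set ℕ) (m : ℕ) :
    r * steinSolution r A m - m * steinSolution r A (m - 1) =
      A.indicator 1 m - (poissonMeasure r).real A := by
  have hr' : (0 : ℝ) < r := hr
  have hind : ∀ m, A.indicator (poissonMass r) m = A.indicator 1 m * poissonMass r m := by
    intro m; by_cases h : m ∈ A <;> simp [h]
  rcases m with _ | m
  · have := poissonMass_pos hr 0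
    simp only [steinSolution, hind, zero_add, Finset.range_one, Finset.sum_singleton]
    field_simp
    simp
  · have h1 := poissonMass_pos hr (m + 1)
    have h0 := poissonMass_pos hr m
    have hs := succ_mul_poissonMass_succ r m
    simp only [Nat.add_sub_cancel, steinSolution]
    rw [Finset.sum_range_succ _ (m + 1), hind (m + 1), ← hs]
    push_cast
    field_simp
    ring

lemma steinSolution_compl (r : ℝ≥0) (A : Set ℕ) (m : ℕ) :
    steinSolution r Aᶜ m = -steinSolution r A m := by
  unfold steinSolution
  rw [← neg_div, ← Finset.sum_neg_distrib]
  congr 1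
  refine Finset.sum_congr rfl fun i _ => ?_
  rw [measureReal_compl MeasurableSet.of_discrete]
  by_cases h : i ∈ A <;> simp [h] <;> ring

lemma poissonMass_logConcave {r : ℝ≥0} {i j : ℕ} (h : i ≤ j) :
    poissonMass r i * poissonMass r (j + 1) ≤ poissonMass r (i + 1) * poissonMass r j := by
  have hi := succ_mul_poissonMass_succ r i
  have hj := succ_mul_poissonMass_succ r j
  have hij : (i : ℝ) ≤ j := by exact_mod_cast h
  have e1 : poissonMass r (i + 1) = r * poissonMass r i / (i + 1) := by
    rw [← hi]; field_simp
  have e2 : poissonMass r (j + 1) = r * poissonMass r j / (j + 1) := by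
    rw [← hj]; field_simp
  rw [e1, e2, mul_div_assoc', div_mul_eq_mul_div]
  have := poissonMass_nonneg r i
  have := poissonMass_nonneg r j
  have hr := r.2
  calc _ ≤ poissonMass r i * (r * poissonMass r j) / (i + 1) := by gcongr
    _ = _ := by ring

/-- Log-concavity, term by term. This and the next lemma give the signs of the contributions to an
increment of g from the points of A above and below the jump. -/
lemma poisson_tail_div_antitone {r : ℝ≥0} (m : ℕ) :
    (∑' j, poissonMass r (j + (m + 2))) * poissonMass r m ≤
      (∑' j, poissonMass r (j + (m + 1))) * poissonMass r (m + 1) := by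
  have hs := (hasSum_poissonMass r).summable
  rw [← tsum_mul_right, ← tsum_mul_right]
  refine Summable.tsum_le_tsum (fun j => ?_)
    (((summable_nat_add_iff (m + 2)).2 hs).mul_right _)
    (((summable_nat_add_iff (m + 1)).2 hs).mul_right _)
  have := poissonMass_logConcave (r := r) (i := m) (j := j + (m + 1)) (by omega)
  rw [mul_comm, mul_comm (poissonMass r (j + (m + 1)))]
  exact this

lemma poisson_head_div_monotone {r : ℝ≥0} (m : ℕ) :
    (∑ i ∈ Finset.range (m + 1), poissonMass r i) * poissonMass r (m + 1) ≤
      (∑ i ∈ Finset.range (m + 2), poissonMass r i) * poissonMass r m := by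
  rw [Finset.sum_range_succ' _ (m + 1), add_mul, Finset.sum_mul, Finset.sum_mul]
  have h0 : 0 ≤ poissonMass r 0 * poissonMass r m :=
    mul_nonneg (poissonMass_nonneg _ _) (poissonMass_nonneg _ _)
  refine (Finset.sum_le_sum fun i hi => ?_).trans (le_add_of_nonneg_right h0)
  exact poissonMass_logConcave (by simpa [Nat.lt_succ_iff] using hi)

/-- For i ≤ m, r π(i)/(m+1) ≤ r π(i)/(i+1) = π(i+1), so the left side is at most 1 - π(0) = 1 -
exp(-r) ≤ r. -/
lemma poisson_tail_add_head_le (r : ℝ≥0) (m : ℕ) :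
    (∑' j, poissonMass r (j + (m + 2))) +
      r / (m + 1) * (∑ i ∈ Finset.range (m + 1), poissonMass r i) ≤ r := by
  have hs := (hasSum_poissonMass r).summable
  have h1 := hs.sum_add_tsum_nat_add (m + 2)
  rw [(hasSum_poissonMass r).tsum_eq, Finset.sum_range_succ'] at h1
  have h2 : r / (m + 1) * (∑ i ∈ Finset.range (m + 1), poissonMass r i) ≤
      ∑ i ∈ Finset.range (m + 1), poissonMass r (i + 1) := by
    rw [Finset.mul_sum]
    refine Finset.sum_le_sum fun i hi => ?_
    have him : (i : ℝ) ≤ m := by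
      exact_mod_cast (by simpa [Nat.lt_succ_iff] using hi : i ≤ m)
    have e := succ_mul_poissonMass_succ r i
    have := poissonMass_nonneg r (i + 1)
    rw [div_mul_eq_mul_div, ← e, div_le_iff₀ (by positivity), mul_comm]
    gcongr
  have h3 : 1 - (r : ℝ) ≤ poissonMass r 0 := by
    have := Real.add_one_le_exp (-(r : ℝ))
    simp only [poissonMass, pow_zero, mul_one, Nat.factorial_zero, Nat.cast_one, div_one]
    linarith
  linarith

/-- The increment from m to m + 1 is additive over the points of A, and only the point m + 1 can
contribute positively. Passing to the complement of A turns this upper bound into a two-sided one.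
-/
lemma steinSolution_sub_le {r : ℝ≥0} (hr : 0 < r) (A : Set ℕ) (m : ℕ) :
    steinSolution r A (m + 1) - steinSolution r A m ≤ 1 := by
  have hr' : (0 : ℝ) < r := hr
  have hp := poissonMass_pos hr m
  have hq := poissonMass_pos hr (m + 1)
  have hs := (hasSum_poissonMass r).summable
  have hu := summable_indicator_poissonMass r A
  have unn : ∀ i, 0 ≤ A.indicator (poissonMass r) i :=
    fun i => Set.indicator_nonneg (fun _ _ => poissonMass_nonneg _ _) _
  have hx1 : A.indicator (poissonMass r) (m + 1) ≤ poissonMass r (m + 1) :=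
    Set.indicator_le_self' (fun _ _ => poissonMass_nonneg _ _) _
  have hx0 := unn (m + 1)
  have ha0 : 0 ≤ ∑ i ∈ Finset.range (m + 1), A.indicator (poissonMass r) i :=
    Finset.sum_nonneg fun i _ => unn i
  have hb0 : 0 ≤ ∑' j, A.indicator (poissonMass r) (j + (m + 2)) := tsum_nonneg fun _ => unn _
  have hA := hu.sum_add_tsum_nat_add (m + 2)
  have h1 := hs.sum_add_tsum_nat_add (m + 2)
  have h1' := hs.sum_add_tsum_nat_add (m + 1)
  have hanti := poisson_tail_div_antitone (r := r) m
  have hmono := poisson_head_div_monotone (r := r) m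
  have hle := poisson_tail_add_head_le r m
  have hrec : poissonMass r (m + 1) = r / (m + 1) * poissonMass r m := by
    have := succ_mul_poissonMass_succ r m
    field_simp
    linarith
  have hF0 : 0 ≤ ∑ i ∈ Finset.range (m + 1), poissonMass r i :=
    Finset.sum_nonneg fun i _ => poissonMass_nonneg _ _
  have hT0 : 0 ≤ ∑' j, poissonMass r (j + (m + 2)) := tsum_nonneg fun _ => poissonMass_nonneg _ _
  rw [(hasSum_poissonMass r).tsum_eq] at h1 h1'
  rw [← poissonMeasure_real_eq_tsum, Finset.sum_range_succ] at hA
  unfold steinSolution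
  rw [Finset.sum_sub_distrib, Finset.sum_sub_distrib, ← Finset.mul_sum, ← Finset.mul_sum,
    Finset.sum_range_succ (A.indicator (poissonMass r)) (m + 1)]
  -- What remains is algebra: a, x, b are the masses of A below, at and above m + 1; F, q, T are
  -- those of all of ℕ.
  generalize (∑ i ∈ Finset.range (m + 1), A.indicator (poissonMass r) i) = a at *
  generalize (∑' j, A.indicator (poissonMass r) (j + (m + 2))) = b at *
  generalize A.indicator (poissonMass r) (m + 1) = x at *
  generalize (poissonMeasure r).real A = P at *
  rw [Finset.sum_range_succ (poissonMass r) (m + 1)] at *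
  generalize (∑ i ∈ Finset.range (m + 1), poissonMass r i) = F at *
  generalize (∑' j, poissonMass r (j + (m + 2))) = T at *
  generalize (∑' j, poissonMass r (j + (m + 1))) = T' at *
  generalize poissonMass r (m + 1) = q at *
  generalize poissonMass r m = p at *
  subst hA
  have key : (a + x - (a + x + b) * (F + q)) * p - (a - (a + x + b) * F) * q ≤ r * (p * q) := by
    have e1 : 1 = F + q + T := h1.symm
    have e2 : T' = q + T := by linarith
    subst e2
    have : (a + x - (a + x + b) * (F + q)) * p - (a - (a + x + b) * F) * q
        = a * (T * p - (q + T) * q) + b * (F * q - (F + q) * p) + x * (T * p + F * q)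
          := by
      linear_combination (p * (a + x) - q * a) * e1
    rw [this]
    have i1 : a * (T * p - (q + T) * q) ≤ 0 := mul_nonpos_of_nonneg_of_nonpos ha0 (by linarith)
    have i2 : b * (F * q - (F + q) * p) ≤ 0 := mul_nonpos_of_nonneg_of_nonpos hb0 (by linarith)
    have i3 : x * (T * p + F * q) ≤ q * (T * p + F * q) := by gcongr
    have i4 : q * (T * p + F * q) = q * p * (T + r / (m + 1) * F) := by
      conv_lhs => rw [mul_add, hrec]
      rw [hrec]; ring
    have i5 : q * p * (T + r / (m + 1) * F) ≤ q * p * r := by gcongr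
    linarith
  rw [div_sub_div _ _ (by positivity) (by positivity), div_le_one (by positivity)]
  have := mul_le_mul_of_nonneg_left key hr'.le
  linarith

lemma abs_steinSolution_sub_le {r : ℝ≥0} (hr : 0 < r) (A : Set ℕ) (m : ℕ) :
    |steinSolution r A (m + 1) - steinSolution r A m| ≤ 1 := by
  refine abs_le.2 ⟨?_, steinSolution_sub_le hr A m⟩
  have := steinSolution_sub_le hr Aᶜ m
  rw [steinSolution_compl, steinSolution_compl] at this
  linarith

/-- Stein's lemma for the Poisson distribution: the Stein equation of an event has a solution
whose increments are bounded by `1`, uniformly in the rate. -/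
lemma exists_stein_solution (r : ℝ≥0) (A : Set ℕ) :
    ∃ g : ℕ → ℝ, (∀ m, |g (m + 1) - g m| ≤ 1) ∧
      ∀ m : ℕ, r * g m - m * g (m - 1) = A.indicator 1 m - (poissonMeasure r).real A := by
  rcases eq_or_ne r 0 with rfl | hr
  · have hP : (poissonMeasure 0).real A = A.indicator 1 0 := by
      rw [poissonMeasure_real_eq_tsum, tsum_eq_single 0]
      · by_cases h : 0 ∈ A <;> simp [h, poissonMass]
      · intro m hm
        simp [poissonMass, hm]
    -- At rate 0 the law is the point mass at 0 and the equation at m + 1 determines g m.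
    -- Consecutive numerators lie in {0, 1} or in {0, -1}, so increments stay within 1.
    refine ⟨fun m => (A.indicator 1 0 - A.indicator 1 (m + 1)) / (m + 1), fun m => ?_, fun m => ?_⟩
    · have h1 : (0 : ℝ) ≤ 1 / (m + 1) := by positivity
      have h2 : (1 : ℝ) / (m + 1) ≤ 1 := by
        rw [div_le_one (by positivity)]; linarith [(Nat.cast_nonneg m : (0 : ℝ) ≤ m)]
      have h3 : (0 : ℝ) ≤ 1 / ((m + 1 : ℕ) + 1) := by positivity
      have h4 : (1 : ℝ) / ((m + 1 : ℕ) + 1) ≤ 1 := by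
        rw [div_le_one (by positivity)]; linarith [(Nat.cast_nonneg (m + 1) : (0 : ℝ) ≤ (m + 1 : ℕ))]
      simp only [div_eq_mul_one_div (A.indicator 1 0 - _ : ℝ)]
      generalize (1 : ℝ) / (m + 1) = s at *
      generalize (1 : ℝ) / ((m + 1 : ℕ) + 1) = t at *
      rw [abs_le]
      by_cases c0 : 0 ∈ A <;> by_cases c1 : m + 1 ∈ A <;> by_cases c2 : m + 1 + 1 ∈ A <;>
        simp [c0, c1, c2] <;> (try constructor) <;> linarith
    · rw [hP]
      rcases m with _ | m
      · simp
      · simp only [NNReal.coe_zero, zero_mul, Nat.add_sub_cancel]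
        push_cast
        field_simp
        ring
  · have hr' : 0 < r := pos_iff_ne_zero.2 hr
    exact ⟨steinSolution r A, abs_steinSolution_sub_le hr' A, steinSolution_equation hr' A⟩

end BallsInBoxes

namespace BallsInBoxes

open scoped BigOperators Finset

/-! ### The Chen–Stein bound for locally dependent indicators -/

section ChenStein

lemma abs_sub_le_of_abs_succ_sub_le {g : ℕ → ℝ} (hg : ∀ m, |g (m + 1) - g m| ≤ 1) (m d : ℕ) :
    |g (m + d) - g m| ≤ d := by
  induction d with
  | zero => simp
  | succ d ih =>
    have := abs_add_le (g (m + d + 1) - g (m + d)) (g (m + d) - g m)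
    rw [sub_add_sub_cancel] at this
    push_cast
    rw [← add_assoc]
    linarith [hg (m + d)]

variable {Ω ι : Type*} [Fintype Ω] [DecidableEq ι]

/-- The **Chen–Stein method** for a sum of `0/1` variables of equal mean `p` with dependency
neighbourhoods `N`, on a finite space with the uniform distribution. -/
lemma chenStein_bound (I : Finset ι) (X : ι → Ω → Prop) [∀ a w, Decidable (X a w)]
    (N : ι → Finset ι) (hN : ∀ a ∈ I, a ∈ N a) (hNI : ∀ a ∈ I, N a ⊆ I) {p : ℝ} (hp : 0 ≤ p)
    (hind : ∀ a ∈ I, ∀ φ : ℕ → ℝ,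
      𝔼 w, (if X a w then φ #{b ∈ I \ N a | X b w} else 0) =
        p * 𝔼 w, φ #{b ∈ I \ N a | X b w})
    {g : ℕ → ℝ} (hg : ∀ m, |g (m + 1) - g m| ≤ 1) :
    |𝔼 w, (p * #I * g #{b ∈ I | X b w} - #{b ∈ I | X b w} * g (#{b ∈ I | X b w} - 1))| ≤
      ∑ a ∈ I, (p * ∑ b ∈ N a, 𝔼 w, (if X b w then (1 : ℝ) else 0) +
        ∑ b ∈ (N a).erase a, 𝔼 w, (if X a w ∧ X b w then (1 : ℝ) else 0)) := by
  set W : Ω → ℕ := fun w => #{b ∈ I | X b w} with hW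
  set V : ι → Ω → ℕ := fun a w => #{b ∈ I \ N a | X b w} with hV
  have hWV : ∀ a ∈ I, ∀ w, W w = V a w + #{b ∈ N a | X b w} := by
    intro a ha w
    simp only [hW, hV]
    rw [← Finset.card_union_of_disjoint, ← Finset.filter_union,
      Finset.sdiff_union_of_subset (hNI a ha)]
    exact Finset.disjoint_filter_filter Finset.sdiff_disjoint
  have hNa : ∀ a ∈ I, ∀ w, X a w →
      #{b ∈ N a | X b w} = #{b ∈ (N a).erase a | X b w} + 1 := by
    intro a ha w hX
    conv_lhs => rw [← Finset.insert_erase (hN a ha), Finset.filter_insert, if_pos hX]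
    rw [Finset.card_insert_of_notMem (by simp)]
  -- Independence of X a and V a allows g (V a) to be subtracted in both terms. The remaining
  -- differences compare g at points whose distance is a count inside the neighbourhood.
  have hdecomp : 𝔼 w, (p * #I * g (W w) - W w * g (W w - 1)) =
      ∑ a ∈ I, (p * 𝔼 w, (g (W w) - g (V a w)) -
        𝔼 w, (if X a w then g (W w - 1) - g (V a w) else 0)) := by
    have h1 : ∀ w, p * #I * g (W w) - W w * g (W w - 1) =
        ∑ a ∈ I, (p * g (W w) - if X a w then g (W w - 1) else 0) := by
      intro w
      rw [Finset.sum_sub_distrib, Finset.sum_const, nsmul_eq_mul, ← Finset.sum_filter,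
        Finset.sum_const, nsmul_eq_mul]
      ring
    simp_rw [h1]
    rw [Finset.expect_sum_comm]
    refine Finset.sum_congr rfl fun a ha => ?_
    have h2 : ∀ w, (if X a w then g (W w - 1) - g (V a w) else 0) =
        (if X a w then g (W w - 1) else 0) - (if X a w then g (V a w) else 0) := by
      intro w; split_ifs <;> simp
    simp_rw [h2]
    rw [Finset.expect_sub_distrib, Finset.expect_sub_distrib, Finset.expect_sub_distrib,
      hind a ha g, ← Finset.mul_expect]
    ring
  rw [hdecomp]
  refine (Finset.abs_sum_le_sum_abs _ _).trans (Finset.sum_le_sum fun a ha => ?_)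
  refine (abs_sub _ _).trans (add_le_add ?_ ?_)
  · rw [abs_mul, abs_of_nonneg hp]
    refine mul_le_mul_of_nonneg_left ?_ hp
    rw [← Finset.expect_sum_comm]
    refine (Finset.abs_expect_le _ _).trans (Finset.expect_le_expect fun w _ => ?_)
    rw [← Finset.sum_filter, Finset.sum_const, nsmul_eq_mul, mul_one, hWV a ha w]
    exact abs_sub_le_of_abs_succ_sub_le hg _ _
  · rw [← Finset.expect_sum_comm]
    refine (Finset.abs_expect_le _ _).trans (Finset.expect_le_expect fun w _ => ?_)
    by_cases hX : X a w
    · simp only [hX, if_true, true_and]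
      rw [← Finset.sum_filter, Finset.sum_const, nsmul_eq_mul, mul_one, hWV a ha w, hNa a ha w hX,
        ← add_assoc, Nat.add_sub_cancel]
      exact abs_sub_le_of_abs_succ_sub_le hg _ _
    · simp [hX]

end ChenStein

/-! ### Sets of balls that share a box -/

section Mono

variable {ι β : Type*} [DecidableEq ι]

/-- The arrangement `b` is constant on `S`: all balls in `S` share a box. -/
def Mono (S : Finset ι) (b : ι → β) : Prop := ∀ x ∈ S, ∀ y ∈ S, b x = b y

instance [DecidableEq β] (S : Finset ι) (b : ι → β) : Decidable (Mono S b) := by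
  unfold Mono; infer_instance

/-- A common ball forces the two boxes to coincide, so joint probabilities of overlapping sets
reduce to that of one set. -/
lemma mono_union {S T : Finset ι} (h : ¬ Disjoint S T) (b : ι → β) :
    Mono (S ∪ T) b ↔ Mono S b ∧ Mono T b := by
  obtain ⟨i, hS, hT⟩ := Finset.not_disjoint_iff.1 h
  refine ⟨fun h => ⟨fun x hx y hy => h x (by simp [hx]) y (by simp [hy]),
    fun x hx y hy => h x (by simp [hx]) y (by simp [hy])⟩, fun ⟨h1, h2⟩ => ?_⟩
  have key : ∀ x ∈ S ∪ T, b x = b i := by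
    intro x hx
    rcases Finset.mem_union.1 hx with hx | hx
    exacts [h1 x hx i hS, h2 x hx i hT]
  intro x hx y hy
  rw [key x hx, key y hy]

lemma mono_update_iff {S : Finset ι} {j : ι} (hj : j ∉ S) (b : ι → β) (v : β) :
    Mono S (Function.update b j v) ↔ Mono S b := by
  have : ∀ x ∈ S, Function.update b j v x = b x := fun x hx =>
    Function.update_of_ne (ne_of_mem_of_not_mem hx hj) _ _
  unfold Mono
  exact forall₂_congr fun x hx => forall₂_congr fun y hy => by rw [this x hx, this y hy]

end Mono

/-! ### Uniform averages over arrangements -/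

section Expect

variable {ι β : Type*} [Fintype ι] [DecidableEq ι] [Fintype β] [Nonempty β]

/-- Resampling one coordinate does not change a uniform average. -/
lemma expect_expect_update (j : ι) (F : (ι → β) → ℝ) :
    𝔼 b, 𝔼 v, F (Function.update b j v) = 𝔼 b, F b := by
  have h1 : 𝔼 b : ι → β, 𝔼 v : β, F (Function.update b j v) =
      𝔼 x : (ι → β) × β, F (Function.update x.1 j x.2) := by
    rw [← Finset.univ_product_univ, Finset.expect_product]
  have h2 : 𝔼 x : (ι → β) × β, F (Function.update x.1 j x.2) = 𝔼 x : (ι → β) × β, F x.1 := by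
    -- Swapping the old value at j with the fresh one preserves the uniform distribution on pairs.
    have hinv : Function.Involutive
        (fun x : (ι → β) × β => (Function.update x.1 j x.2, x.1 j)) := by
      rintro ⟨b, v⟩
      simp
    exact Fintype.expect_equiv hinv.toPerm _ _ fun x => rfl
  rw [h1, h2, ← Finset.univ_product_univ, Finset.expect_product]
  simp

/-- Being constant on `S` has probability `|β| ^ (1 - |S|)` and is independent of every function
of the coordinates outside `S`. -/
lemma expect_mono_mul [DecidableEq β] {S : Finset ι} (hS : S.Nonempty) (G : (ι → β) → ℝ)
    (hG : ∀ j ∈ S, ∀ b v, G (Function.update b j v) = G b) :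
    𝔼 b, (if Mono S b then G b else 0) = ((Fintype.card β : ℝ)⁻¹) ^ (#S - 1) * 𝔼 b, G b := by
  induction hS using Finset.Nonempty.cons_induction with
  | singleton i => simp [Mono]
  | cons j S hj hS ih =>
    obtain ⟨i, hi⟩ := hS
    have hij : i ≠ j := fun h => hj (h ▸ hi)
    have hmono : ∀ b : ι → β, Mono (Finset.cons j S hj) b ↔ Mono S b ∧ b i = b j := by
      intro b
      constructor
      · intro h
        exact ⟨fun x hx y hy => h x (by simp [hx]) y (by simp [hy]),
          h i (by simp [hi]) j (by simp)⟩
      · rintro ⟨h, h'⟩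
        have key : ∀ x ∈ Finset.cons j S hj, b x = b i := by
          intro x hx
          rcases Finset.mem_cons.1 hx with rfl | hx
          exacts [h'.symm, h x hx i hi]
        intro x hx y hy
        rw [key x hx, key y hy]
    have hcard : #(Finset.cons j S hj) - 1 = (#S - 1) + 1 := by
      have : 0 < #S := Finset.card_pos.2 ⟨i, hi⟩
      rw [Finset.card_cons]; omega
    -- Resampling ball j affects neither G nor `Mono S`; the fresh value hits the box of i with
    -- probability 1 / |β|.
    rw [← expect_expect_update j, hcard, pow_succ, mul_right_comm,
      ← ih fun j' hj' => hG j' (by simp [hj']), Finset.expect_mul]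
    refine Finset.expect_congr rfl fun b _ => ?_
    simp only [hmono, mono_update_iff hj, hG j (by simp), Function.update_of_ne hij,
      Function.update_self, ite_and]
    by_cases h : Mono S b
    · simp only [h, if_true]
      rw [Finset.expect_eq_sum_div_card, Finset.sum_ite_eq]
      simp [div_eq_mul_inv]
    · simp [h]

lemma expect_mono [DecidableEq β] {S : Finset ι} (hS : S.Nonempty) :
    𝔼 b : ι → β, (if Mono S b then (1 : ℝ) else 0) =
      ((Fintype.card β : ℝ)⁻¹) ^ (#S - 1) := by
  rw [expect_mono_mul hS (fun _ => 1) fun _ _ _ _ => rfl]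
  simp

/-- The number of pairs of `r`-sets whose union has `u` elements is at most `4 ^ u * |ι| ^ u`. -/
lemma card_pairs_union_card_eq_le (r u : ℕ) :
    #{x ∈ Finset.powersetCard r (Finset.univ : Finset ι) ×ˢ Finset.powersetCard r Finset.univ |
      #(x.1 ∪ x.2) = u} ≤ 4 ^ u * Fintype.card ι ^ u := by
  have hsub : {x ∈ Finset.powersetCard r (Finset.univ : Finset ι) ×ˢ
      Finset.powersetCard r (Finset.univ : Finset ι) | #(x.1 ∪ x.2) = u} ⊆
      (Finset.powersetCard u (Finset.univ : Finset ι)).biUnion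
        fun U => U.powerset ×ˢ U.powerset := by
    rintro ⟨S, T⟩ h
    simp only [Finset.mem_filter] at h
    simp only [Finset.mem_biUnion, Finset.mem_powersetCard_univ, Finset.mem_product,
      Finset.mem_powerset]
    exact ⟨S ∪ T, h.2, Finset.subset_union_left, Finset.subset_union_right⟩
  refine (Finset.card_le_card hsub).trans ((Finset.card_biUnion_le_card_mul _ _ (4 ^ u)
    fun U hU => ?_).trans ?_)
  · rw [Finset.card_product, Finset.card_powerset, (Finset.mem_powersetCard.1 hU).2, ← mul_pow]
    norm_num
  · rw [Finset.card_powersetCard, mul_comm, Finset.card_univ]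
    exact Nat.mul_le_mul_left _ (Nat.choose_le_pow _ _)

end Expect

/-! ### Counting the error terms for triple matches -/

section Triples

lemma tripleMatches_eq_card_mono {n k : ℕ} (b : Fin k → Fin n) :
    tripleMatches b = #{S ∈ Finset.powersetCard 3 (Finset.univ : Finset (Fin k)) | Mono S b} := by
  unfold tripleMatches
  refine Finset.card_nbij (fun t => {t.1, t.2.1, t.2.2}) ?_ ?_ ?_
  · rintro ⟨x, y, z⟩ h
    simp only [Finset.coe_filter, Finset.mem_univ, true_and, Set.mem_ofPred_eq] at h
    obtain ⟨hxy, hyz, h1, h2⟩ := h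
    rw [Finset.mem_coe, Finset.mem_filter, Finset.mem_powersetCard_univ]
    refine ⟨Finset.card_eq_three.2 ⟨x, y, z, hxy.ne, (hxy.trans hyz).ne, hyz.ne, rfl⟩, ?_⟩
    have key : ∀ w ∈ ({x, y, z} : Finset (Fin k)), b w = b y := by
      intro w hw
      simp only [Finset.mem_insert, Finset.mem_singleton] at hw
      rcases hw with rfl | rfl | rfl
      exacts [h1, rfl, h2.symm]
    intro u hu v hv
    rw [key u hu, key v hv]
  · rintro ⟨x, y, z⟩ h ⟨x', y', z'⟩ h' heq
    simp only [Finset.coe_filter, Finset.mem_univ, true_and, Set.mem_ofPred_eq] at h h'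
    simp only [Finset.ext_iff, Finset.mem_insert, Finset.mem_singleton] at heq
    have := heq x
    have := heq y
    have := heq z
    have := heq x'
    have := heq y'
    have := heq z'
    simp only [Prod.mk.injEq]
    omega
  · intro S hS
    rw [Finset.mem_coe, Finset.mem_filter, Finset.mem_powersetCard_univ] at hS
    obtain ⟨hc, hm⟩ := hS
    have hmem := S.orderEmbOfFin_mem hc
    refine ⟨(S.orderEmbOfFin hc 0, S.orderEmbOfFin hc 1, S.orderEmbOfFin hc 2), ?_, ?_⟩
    · simp only [Finset.coe_filter, Finset.mem_univ, true_and, Set.mem_ofPred_eq,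
        OrderEmbedding.lt_iff_lt]
      exact ⟨by decide, by decide, hm _ (hmem _) _ (hmem _), hm _ (hmem _) _ (hmem _)⟩
    · ext x
      have hx := Set.ext_iff.1 (S.range_orderEmbOfFin hc) x
      rw [Set.mem_range, Finset.mem_coe] at hx
      rw [← hx]
      simp [Fin.exists_fin_succ, eq_comm]

variable {n k : ℕ} [NeZero n]

lemma dropLaw_real_apply (s : Set (Fin k → Fin n)) [DecidablePred (· ∈ s)] :
    (dropLaw n k).real s = 𝔼 b, (if b ∈ s then (1 : ℝ) else 0) := by
  classical
  have hsing : ∀ b : Fin k → Fin n, (dropLaw n k).real {b} = ((n : ℝ) ^ k)⁻¹ := by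
    intro b
    rw [measureReal_def, dropLaw, Measure.pi_singleton]
    simp
  have hs : s = ↑({b | b ∈ s} : Finset (Fin k → Fin n)) := by simp
  conv_lhs => rw [hs]
  rw [← sum_measureReal_singleton, Finset.expect_eq_sum_div_card, ← Finset.sum_filter]
  simp [hsing, div_eq_mul_inv]

/-- The Chen–Stein estimate for triple matches, before the error terms are counted. -/
lemma abs_law_sub_poisson_le (A : Set ℕ) :
    |((dropLaw n k).map tripleMatches).real A -
        (poissonMeasure ((k.choose 3 : ℝ≥0) / (n : ℝ≥0) ^ 2)).real A| ≤
      k.choose 3 * ((n : ℝ)⁻¹) ^ 4 + 2 * (((n : ℝ)⁻¹) ^ 3 * (4 ^ 4 * (k : ℝ) ^ 4) +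
        ((n : ℝ)⁻¹) ^ 4 * (4 ^ 5 * (k : ℝ) ^ 5)) := by
  classical
  set r : ℝ≥0 := (k.choose 3 : ℝ≥0) / (n : ℝ≥0) ^ 2 with hr
  set q : ℝ := (n : ℝ)⁻¹ with hq
  have hq0 : 0 ≤ q := by positivity
  have hq1 : q ≤ 1 := inv_le_one_of_one_le₀ (by exact_mod_cast NeZero.one_le)
  set I := Finset.powersetCard 3 (Finset.univ : Finset (Fin k)) with hI
  have hIcard : ∀ a ∈ I, #a = 3 := fun a ha => (Finset.mem_powersetCard.1 ha).2
  have hIne : ∀ a ∈ I, a.Nonempty := fun a ha => Finset.card_pos.1 (by rw [hIcard a ha]; norm_num)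
  have hcard : (#I : ℝ) = k.choose 3 := by simp [hI]
  obtain ⟨g, hg, hstein⟩ := exists_stein_solution r A
  have hrI : (r : ℝ) = q ^ 2 * #I := by
    rw [hcard, hr, hq]; push_cast; rw [inv_pow]; ring
  have hlaw : ((dropLaw n k).map tripleMatches).real A - (poissonMeasure r).real A =
      𝔼 b : Fin k → Fin n, (q ^ 2 * #I * g #{S ∈ I | Mono S b} -
        #{S ∈ I | Mono S b} * g (#{S ∈ I | Mono S b} - 1)) := by
    rw [map_measureReal_apply Measurable.of_discrete MeasurableSet.of_discrete,
      dropLaw_real_apply, ← Fintype.expect_const (ι := Fin k → Fin n) ((poissonMeasure r).real A),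
      ← Finset.expect_sub_distrib]
    refine Finset.expect_congr rfl fun b _ => ?_
    rw [← hrI, hstein, ← tripleMatches_eq_card_mono]
    simp [Set.indicator_apply]
  set N : Finset (Fin k) → Finset (Finset (Fin k)) := fun a => {b ∈ I | ¬ Disjoint a b} with hN
  have hself : ∀ a ∈ I, a ∈ N a := by
    intro a ha
    simp only [hN, Finset.mem_filter, disjoint_self, Finset.bot_eq_empty]
    exact ⟨ha, (hIne a ha).ne_empty⟩
  rw [hlaw]
  refine (chenStein_bound I (fun S (b : Fin k → Fin n) => Mono S b) N hself
    (fun a _ => Finset.filter_subset _ _) (p := q ^ 2) (by positivity) ?_ hg).trans ?_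
  · intro a ha φ
    rw [expect_mono_mul (hIne a ha) (fun b => φ #{S ∈ I \ N a | Mono S b}), hIcard a ha]
    · simp [hq]
    · intro j hj b v
      congr 2
      refine Finset.filter_congr fun S hS => mono_update_iff (fun hjS => ?_) b v
      simp only [hN, Finset.mem_sdiff, Finset.mem_filter, not_and, not_not] at hS
      exact Finset.disjoint_left.1 (hS.2 hS.1) hj hjS
  -- The term b = a occurs only in the first sum and gives q⁴. Any other b gives q⁴ there and q³ or
  -- q⁴ in the second sum; as q ≤ 1, twice the second covers both.
  · have hterm : ∀ a ∈ I, (q ^ 2 * ∑ b ∈ N a, 𝔼 w : Fin k → Fin n, (if Mono b w then (1 : ℝ) else 0) +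
        ∑ b ∈ (N a).erase a, 𝔼 w : Fin k → Fin n, (if Mono a w ∧ Mono b w then (1 : ℝ) else 0)) ≤
        q ^ 4 + 2 * ∑ b ∈ I, ((if #(a ∪ b) = 4 then q ^ 3 else 0) +
          (if #(a ∪ b) = 5 then q ^ 4 else 0)) := by
      intro a ha
      have e1 : ∀ b ∈ N a, 𝔼 w : Fin k → Fin n, (if Mono b w then (1 : ℝ) else 0) = q ^ 2 := by
        intro b hb
        have hb := (Finset.mem_filter.1 hb).1
        rw [expect_mono (hIne b hb), hIcard b hb]
        simp [hq]
      rw [Finset.sum_congr rfl e1, ← Finset.add_sum_erase _ _ (hself a ha), mul_add, ← pow_add,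
        add_assoc, Finset.mul_sum, ← Finset.sum_add_distrib, Finset.mul_sum]
      refine add_le_add le_rfl ((Finset.sum_le_sum fun b hb => ?_).trans
        (Finset.sum_le_sum_of_subset_of_nonneg
          ((Finset.erase_subset _ _).trans (Finset.filter_subset _ _)) fun b _ _ => by positivity))
      obtain ⟨hne, hb⟩ := Finset.mem_erase.1 hb
      obtain ⟨hbI, hdis⟩ := Finset.mem_filter.1 hb
      simp_rw [← mono_union hdis]
      rw [expect_mono ((hIne a ha).mono Finset.subset_union_left)]
      have hinter : 0 < #(a ∩ b) := by
        rw [Finset.card_pos, Finset.nonempty_iff_ne_empty]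
        exact fun h => hdis (Finset.disjoint_iff_inter_eq_empty.2 h)
      have hui := Finset.card_union_add_card_inter a b
      rw [hIcard a ha, hIcard b hbI] at hui
      have hlt : 3 < #(a ∪ b) := by
        by_contra hle
        have h1 : a = a ∪ b := Finset.eq_of_subset_of_card_le Finset.subset_union_left
          (by rw [hIcard a ha]; omega)
        have h2 : b = a ∪ b := Finset.eq_of_subset_of_card_le Finset.subset_union_right
          (by rw [hIcard b hbI]; omega)
        exact hne (h2.trans h1.symm)
      have hq43 : q ^ 4 ≤ q ^ 3 := pow_le_pow_of_le_one hq0 hq1 (by norm_num)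
      have : #(a ∪ b) = 4 ∨ #(a ∪ b) = 5 := by omega
      rcases this with h | h <;> simp only [h, Fintype.card_fin, ← hq] <;> norm_num <;>
        nlinarith
    refine (Finset.sum_le_sum hterm).trans ?_
    have hpairs : ∀ (u : ℕ) (c : ℝ), 0 ≤ c →
        ∑ a ∈ I, ∑ b ∈ I, (if #(a ∪ b) = u then c else 0) ≤ c * (4 ^ u * (k : ℝ) ^ u) := by
      intro u c hc
      rw [← Finset.sum_product' I I (fun a b => if #(a ∪ b) = u then c else 0),
        ← Finset.sum_filter, Finset.sum_const, nsmul_eq_mul, mul_comm]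
      refine mul_le_mul_of_nonneg_left ?_ hc
      have := card_pairs_union_card_eq_le (ι := Fin k) 3 u
      rw [Fintype.card_fin] at this
      exact_mod_cast this
    rw [Finset.sum_add_distrib, Finset.sum_const, nsmul_eq_mul, hcard, ← Finset.mul_sum]
    simp_rw [Finset.sum_add_distrib]
    gcongr
    · exact hpairs 4 _ (by positivity)
    · exact hpairs 5 _ (by positivity)

/-- The rate of Poisson approximation for the number of triple matches. -/
lemma tvDist_tripleMatches_le :
    tvDist ((dropLaw n k).map tripleMatches)
      (poissonMeasure ((k.choose 3 : ℝ≥0) / (n : ℝ≥0) ^ 2)) ≤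
      2561 * ((k : ℝ) ^ 4 / (n : ℝ) ^ 3) := by
  have hn : (1 : ℝ) ≤ n := by exact_mod_cast NeZero.one_le
  have hn0 : (0 : ℝ) < n := by linarith
  refine ciSup_le fun A => ?_
  rcases le_or_gt k n with hkn | hkn
  · refine (abs_law_sub_poisson_le A.1).trans ?_
    have hkn' : (k : ℝ) ≤ n := by exact_mod_cast hkn
    have h1 : (k.choose 3 : ℝ) ≤ (k : ℝ) ^ 4 * n := by
      rcases Nat.eq_zero_or_pos k with rfl | hk
      · simp
      · have hk1 : (1 : ℝ) ≤ k := by exact_mod_cast hk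
        calc (k.choose 3 : ℝ) ≤ (k : ℝ) ^ 3 := by exact_mod_cast Nat.choose_le_pow k 3
          _ ≤ (k : ℝ) ^ 4 := pow_le_pow_right₀ hk1 (by norm_num)
          _ ≤ (k : ℝ) ^ 4 * n := le_mul_of_one_le_right (by positivity) hn
    have h2 : (k : ℝ) ^ 5 ≤ (k : ℝ) ^ 4 * n := by rw [pow_succ]; gcongr
    rw [inv_pow, inv_pow]
    have h3 : ((n : ℝ) ^ 4)⁻¹ * ((k : ℝ) ^ 4 * n) = (k : ℝ) ^ 4 / (n : ℝ) ^ 3 := by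
      field_simp
    have h4 : ((n : ℝ) ^ 3)⁻¹ * (k : ℝ) ^ 4 = (k : ℝ) ^ 4 / (n : ℝ) ^ 3 := by
      field_simp
    have hp : 0 ≤ ((n : ℝ) ^ 4)⁻¹ := by positivity
    have := mul_le_mul_of_nonneg_left h1 hp
    have := mul_le_mul_of_nonneg_left h2 hp
    rw [h3] at *
    linarith
  · have : IsProbabilityMeasure ((dropLaw n k).map (tripleMatches : (Fin k → Fin n) → ℕ)) :=
      Measure.isProbabilityMeasure_map Measurable.of_discrete.aemeasurable
    have hkn' : (n : ℝ) ≤ k := by exact_mod_cast hkn.le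
    have h1 : (1 : ℝ) ≤ (k : ℝ) ^ 4 / (n : ℝ) ^ 3 := by
      rw [one_le_div (by positivity)]
      calc (n : ℝ) ^ 3 ≤ (n : ℝ) ^ 4 := pow_le_pow_right₀ hn (by norm_num)
        _ ≤ _ := by gcongr
    refine le_trans ?_ (h1.trans (by linarith))
    rw [abs_le]
    constructor <;>
      linarith [measureReal_nonneg (μ := (dropLaw n k).map tripleMatches) (s := A.1),
        measureReal_le_one (μ := (dropLaw n k).map tripleMatches) (s := A.1),
        measureReal_nonneg (μ := poissonMeasure ((k.choose 3 : ℝ≥0) / (n : ℝ≥0) ^ 2)) (s := A.1),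
        measureReal_le_one (μ := poissonMeasure ((k.choose 3 : ℝ≥0) / (n : ℝ≥0) ^ 2)) (s := A.1)]

end Triples

end BallsInBoxes

/-! ### The limit k ~ θ n^(2/3) -/

namespace BallsInBoxes

lemma abs_sub_le_tvDist {α : Type*} [MeasurableSpace α] (μ ν : Measure α)
    [IsProbabilityMeasure μ] [IsProbabilityMeasure ν] {A : Set α} (hA : MeasurableSet A) :
    |μ.real A - ν.real A| ≤ tvDist μ ν := by
  -- A real supremum bounds its members only if the family is bounded above; here 1 is a bound.
  refine le_ciSup (f := fun A : {A : Set α // MeasurableSet A} => |μ.real A - ν.real A|)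
    ⟨1, ?_⟩ ⟨A, hA⟩
  rintro _ ⟨B, rfl⟩
  dsimp only
  rw [abs_le]
  constructor <;>
    linarith [measureReal_nonneg (μ := μ) (s := B.1), measureReal_le_one (μ := μ) (s := B.1),
      measureReal_nonneg (μ := ν) (s := B.1), measureReal_le_one (μ := ν) (s := B.1)]

lemma tendsto_poissonMeasure_real {ι : Type*} {l : Filter ι} {r : ι → ℝ≥0} {s : ℝ≥0}
    (h : Tendsto (fun i => (r i : ℝ)) l (𝓝 s)) (A : Set ℕ) :
    Tendsto (fun i => (poissonMeasure (r i)).real A) l (𝓝 ((poissonMeasure s).real A)) := by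
  simp_rw [poissonMeasure_real_eq_tsum]
  refine tendsto_tsum_of_dominated_convergence
    (bound := fun m : ℕ => ((s : ℝ) + 1) ^ m / m.factorial)
    (Real.summable_pow_div_factorial _) (fun m => ?_) ?_
  · by_cases hm : m ∈ A
    · simp only [hm, Set.indicator_of_mem, poissonMass]
      exact (((Real.continuous_exp.tendsto _).comp h.neg).mul (h.pow m)).div_const _
    · simpa [hm] using tendsto_const_nhds
  · filter_upwards [h.eventually_le_const (lt_add_one (s : ℝ))] with i hi m
    rw [Real.norm_eq_abs, abs_of_nonneg (Set.indicator_nonneg (fun _ _ => poissonMass_nonneg _ _) _)]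
    refine (Set.indicator_le_self' (fun _ _ => poissonMass_nonneg _ _) _).trans ?_
    unfold poissonMass
    have h1 : Real.exp (-(r i : ℝ)) ≤ 1 := Real.exp_le_one_iff.2 (by simp)
    gcongr
    calc _ ≤ 1 * (r i : ℝ) ^ m := by gcongr
      _ ≤ _ := by rw [one_mul]; gcongr

lemma tendsto_choose_three_div_sq {n k : ℕ → ℕ} {θ : ℝ} (hn0 : ∀ j, n j ≠ 0)
    (hn : Tendsto n atTop atTop)
    (hk : Tendsto (fun j => (k j : ℝ) / (n j : ℝ) ^ (2 / 3 : ℝ)) atTop (𝓝 θ)) :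
    Tendsto (fun j => ((k j).choose 3 : ℝ) / (n j : ℝ) ^ 2) atTop (𝓝 (θ ^ 3 / 6)) := by
  have hnR : Tendsto (fun j => (n j : ℝ)) atTop atTop := tendsto_natCast_atTop_atTop.comp hn
  have hpow : Tendsto (fun j => (n j : ℝ) ^ (2 / 3 : ℝ)) atTop atTop :=
    (tendsto_rpow_atTop (by norm_num)).comp hnR
  have hinv : Tendsto (fun j => ((n j : ℝ) ^ (2 / 3 : ℝ))⁻¹) atTop (𝓝 0) :=
    tendsto_inv_atTop_zero.comp hpow
  -- With y = n^(2/3) and x = k/y, the rate is x(x - 1/y)(x - 2/y)/6, since y³ = n².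
  have hlim := ((hk.mul (hk.sub hinv)).mul (hk.sub (hinv.const_mul 2))).div_const 6
  have e : θ * (θ - 0) * (θ - 2 * 0) / 6 = θ ^ 3 / 6 := by ring
  rw [e] at hlim
  refine hlim.congr fun j => ?_
  have hpos : (0 : ℝ) < n j := by exact_mod_cast Nat.pos_of_ne_zero (hn0 j)
  have h3 : ((n j : ℝ) ^ (2 / 3 : ℝ)) ^ 3 = (n j : ℝ) ^ 2 := by
    rw [← Real.rpow_natCast, ← Real.rpow_mul hpos.le, ← Real.rpow_natCast]
    norm_num
  have hx : 0 < (n j : ℝ) ^ (2 / 3 : ℝ) := Real.rpow_pos_of_pos hpos _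
  rw [← h3, Nat.cast_choose_eq_descPochhammer_div]
  simp only [descPochhammer_succ_eval, descPochhammer_zero, Polynomial.eval_one, Nat.factorial]
  push_cast
  field_simp
  ring

lemma tendsto_pow_four_div_cube {n k : ℕ → ℕ} {θ : ℝ} (hn0 : ∀ j, n j ≠ 0)
    (hn : Tendsto n atTop atTop)
    (hk : Tendsto (fun j => (k j : ℝ) / (n j : ℝ) ^ (2 / 3 : ℝ)) atTop (𝓝 θ)) :
    Tendsto (fun j => (k j : ℝ) ^ 4 / (n j : ℝ) ^ 3) atTop (𝓝 0) := by
  have hnR : Tendsto (fun j => (n j : ℝ)) atTop atTop := tendsto_natCast_atTop_atTop.comp hn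
  have hpow : Tendsto (fun j => (n j : ℝ) ^ (-(1 / 3) : ℝ)) atTop (𝓝 0) :=
    (tendsto_rpow_neg_atTop (by norm_num)).comp hnR
  -- Here k⁴/n³ = (k/n^(2/3))⁴ · n^(-1/3).
  have hlim := (hk.pow 4).mul hpow
  rw [mul_zero] at hlim
  refine hlim.congr fun j => ?_
  have hpos : (0 : ℝ) < n j := by exact_mod_cast Nat.pos_of_ne_zero (hn0 j)
  have h1 : ((n j : ℝ) ^ (2 / 3 : ℝ)) ^ 4 = (n j : ℝ) ^ 3 * (n j : ℝ) ^ (-(1 / 3) : ℝ) := by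
    rw [← Real.rpow_natCast, ← Real.rpow_mul hpos.le, ← Real.rpow_natCast, ← Real.rpow_add hpos]
    norm_num
  have hx : 0 < (n j : ℝ) ^ (-(1 / 3) : ℝ) := Real.rpow_pos_of_pos hpos _
  rw [div_pow, h1]
  field_simp

lemma tendstoInDistribution_tripleMatches {θ : ℝ≥0} (n k : ℕ → ℕ)
    [∀ j, NeZero (n j)] (hn : Tendsto n atTop atTop)
    (hk : Tendsto (fun j => (k j : ℝ) / (n j : ℝ) ^ (2 / 3 : ℝ)) atTop (𝓝 (θ : ℝ))) :
    TendstoInDistribution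
      (fun j => (tripleMatches : (Fin (k j) → Fin (n j)) → ℕ)) atTop (id : ℕ → ℕ)
      (fun j => dropLaw (n j) (k j)) (poissonMeasure (θ ^ 3 / 6)) where
  forall_aemeasurable _ := Measurable.of_discrete.aemeasurable
  tendsto := by
    have hn0 : ∀ j, n j ≠ 0 := fun j => NeZero.ne _
    have hprob : ∀ j, IsProbabilityMeasure
        ((dropLaw (n j) (k j)).map (tripleMatches : (Fin (k j) → Fin (n j)) → ℕ)) :=
      fun j => Measure.isProbabilityMeasure_map Measurable.of_discrete.aemeasurable
    -- By the portmanteau theorem a liminf bound on open sets suffices; the probability of G in fact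
    -- converges.
    refine tendsto_of_forall_isOpen_le_liminf' fun G _ => ?_
    simp only [ProbabilityMeasure.coe_mk, Measure.map_id]
    refine (Tendsto.liminf_eq ?_).ge
    rw [← ENNReal.tendsto_toReal_iff (fun j => measure_ne_top _ _) (measure_ne_top _ _)]
    change Tendsto (fun j => ((dropLaw (n j) (k j)).map tripleMatches).real G) atTop
      (𝓝 ((poissonMeasure (θ ^ 3 / 6)).real G))
    have hrate : Tendsto
        (fun j => ((((k j).choose 3 : ℝ≥0) / (n j : ℝ≥0) ^ 2 : ℝ≥0) : ℝ)) atTop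
        (𝓝 ((θ ^ 3 / 6 : ℝ≥0) : ℝ)) := by
      push_cast
      exact tendsto_choose_three_div_sq hn0 hn hk
    have hpoi := tendsto_poissonMeasure_real hrate G
    have herr := (tendsto_pow_four_div_cube hn0 hn hk).const_mul 2561
    rw [mul_zero] at herr
    have hdiff := squeeze_zero_norm
      (f := fun j => ((dropLaw (n j) (k j)).map tripleMatches).real G -
        (poissonMeasure (((k j).choose 3 : ℝ≥0) / (n j : ℝ≥0) ^ 2)).real G)
      (fun j => (abs_sub_le_tvDist _ _ MeasurableSet.of_discrete).trans tvDist_tripleMatches_le)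
      herr
    simpa using hdiff.add hpoi

lemma poissonMeasure_ne_dirac {r : ℝ≥0} (hr : 0 < r) (m : ℕ) :
    poissonMeasure r ≠ Measure.dirac m := by
  intro h
  have := poissonMeasure_real_singleton_pos (m + 1) hr
  rw [h, measureReal_def, Measure.dirac_apply] at this
  simp at this

end BallsInBoxes

theorem theorem8 :
    (∃ C : ℝ, ∀ (n k : ℕ) [NeZero n],
      BallsInBoxes.tvDist
          ((BallsInBoxes.dropLaw n k).map BallsInBoxes.tripleMatches)
          (poissonMeasure ((k.choose 3 : ℝ≥0) / (n : ℝ≥0) ^ 2))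
        ≤ C * ((k : ℝ) ^ 4 / (n : ℝ) ^ 3)) ∧
    (∀ (θ : ℝ≥0), 0 < θ →
      (∀ (n k : ℕ → ℕ) [∀ j, NeZero (n j)],
        Tendsto n atTop atTop →
        Tendsto (fun j => (k j : ℝ) / (n j : ℝ) ^ (2 / 3 : ℝ)) atTop (𝓝 (θ : ℝ)) →
        TendstoInDistribution
          (fun j => (BallsInBoxes.tripleMatches : (Fin (k j) → Fin (n j)) → ℕ)) atTop
          (id : ℕ → ℕ)
          (fun j => BallsInBoxes.dropLaw (n j) (k j))
          (poissonMeasure (θ ^ 3 / 6))) ∧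
      (∀ m : ℕ, poissonMeasure (θ ^ 3 / 6) ≠ Measure.dirac m)) := by
  refine ⟨⟨2561, fun n k _ => BallsInBoxes.tvDist_tripleMatches_le⟩, fun θ hθ => ⟨?_, fun m => ?_⟩⟩
  · intro n k _ hn hk
    exact BallsInBoxes.tendstoInDistribution_tripleMatches n k hn hk
  · exact BallsInBoxes.poissonMeasure_ne_dirac (by positivity) m
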